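/- Fix $m,\varepsilon>0$ and let $\Lambda$ be the set of all $(x,t)\in\mathbb{R}^2$ such that $2x/\varepsilon,\ 2t/\varepsilon,\ (x+t)/\varepsilon\in\mathbb{Z}$; it is the disjoint union of $\varepsilon\mathbb{Z}^2$ and its dual lattice. For $0<\delta<1$ consider pairs of functions $A_1,A_2\colon\Lambda\to\mathbb{C}$ satisfying the following three axioms. 1. For each $(x,t)\in\Lambda$ with $2x/\varepsilon$ and $2t/\varepsilon$ even, $$A_1(x,t)=\frac{1}{\sqrt{1+m^2\varepsilon^2}}\left(A_1\left(x+\tfrac{\varepsilon}{2},t-\tfrac{\varepsilon}{2}\right)+m\varepsilon\,A_2\left(x+\tfrac{\varepsilon}{2},t-\tfrac{\varepsilon}{2}\right)\right),$$ $$A_2(x,t)=\frac{1}{\sqrt{1+m^2\varepsilon^2}}\left(A_2\left(x-\tfrac{\varepsilon}{2},t-\tfrac{\varepsilon}{2}\right)-m\varepsilon\,A_1\left(x-\tfrac{\varepsilon}{2},t-\tfrac{\varepsilon}{2}\right)\right)+2\delta_{x0}\delta_{t0},$$ where $\delta_{xy}$ is the Kronecker delta. 2. For each $(x,t)\in\Lambda$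 with $2x/\varepsilon$ and $2t/\varepsilon$ odd, $$A_1(x,t)=\frac{1}{\sqrt{1-\delta^2}}\left(A_1\left(x+\tfrac{\varepsilon}{2},t-\tfrac{\varepsilon}{2}\right)-i\delta\,A_2\left(x+\tfrac{\varepsilon}{2},t-\tfrac{\varepsilon}{2}\right)\right),$$ $$A_2(x,t)=\frac{1}{\sqrt{1-\delta^2}}\left(A_2\left(x-\tfrac{\varepsilon}{2},t-\tfrac{\varepsilon}{2}\right)+i\delta\,A_1\left(x-\tfrac{\varepsilon}{2},t-\tfrac{\varepsilon}{2}\right)\right).$$ 3. $\sum_{(x,t)\in\varepsilon\mathbb{Z}^2}\left(|A_1(x,t)|^2+|A_2(x,t)|^2\right)<\infty$. **Proposition (Fourier integral).** For each $\delta\in(0,1)$ there is a unique pair $A_k(x,t)=A_k(x,t,m,\varepsilon,\delta)$, $k\in\{1,2\}$, satisfying these axioms. For each $(x,t)\in\varepsilon\mathbb{Z}^2$ and $k\in\{1,2\}$ the limit (the *lattice propagator*) $$\widetilde A_k(x,t,m,\varepsilon):=\lim_{\delta\searrow0}A_k(x,t,m,\varepsilon,\delta)$$ exists, and $$\widetilde{A}_1(x,t,m,\varepsilon)=\pm\frac{im\varepsilon^2}{2\pi}\int_{-\pi/\varepsilon}^{\pi/\varepsilon}\frac{e^{ipx-i\omega_pt}\,dp}{\sqrt{m^2\varepsilon^2+\sin^2(p\varepsilon)}},$$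 $$\widetilde{A}_2(x,t,m,\varepsilon)=\pm\frac{\varepsilon}{2\pi}\int_{-\pi/\varepsilon}^{\pi/\varepsilon}\left(1+\frac{\sin(p\varepsilon)}{\sqrt{m^2\varepsilon^2+\sin^2(p\varepsilon)}}\right)e^{ipx-i\omega_pt}\,dp,$$ where $$\omega_p:=\frac1\varepsilon\arccos\left(\frac{\cos p\varepsilon}{\sqrt{1+m^2\varepsilon^2}}\right),$$ and the minus sign in the expression for $\widetilde A_k$ is taken exactly when $t<0$ and $(x+t)/\varepsilon+k$ is even. -/

import Mathlib

open Complex Filter Topology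

noncomputable section

/-- The real number `r` is an even integer. -/
def IsEvenInteger (r : ℝ) : Prop := ∃ n : ℤ, Even n ∧ r = (n : ℝ)

/-- The real number `r` is an odd integer. -/
def IsOddInteger (r : ℝ) : Prop := ∃ n : ℤ, Odd n ∧ r = (n : ℝ)

/-- The union of the lattice `ε ℤ²` and its dual: the set of all `(x, t) ∈ ℝ²` such that
`2x/ε`, `2t/ε` and `(x+t)/ε` are integers. -/
def fullLattice (ε : ℝ) : Set (ℝ × ℝ) :=
  {q | (∃ a : ℤ, 2 * q.1 / ε = (a : ℝ)) ∧ (∃ b : ℤ, 2 * q.2 / ε = (b : ℝ)) ∧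
    ∃ c : ℤ, (q.1 + q.2) / ε = (c : ℝ)}

/-- The space coordinate of a lattice point. -/
abbrev xCoord {ε : ℝ} (z : fullLattice ε) : ℝ := z.1.1

/-- The time coordinate of a lattice point. -/
abbrev tCoord {ε : ℝ} (z : fullLattice ε) : ℝ := z.1.2

/-- The lattice point belongs to `ε ℤ²`, that is, `2x/ε` and `2t/ε` are even integers. -/
def IsPrimalPoint {ε : ℝ} (z : fullLattice ε) : Prop :=
  IsEvenInteger (2 * xCoord z / ε) ∧ IsEvenInteger (2 * tCoord z / ε)

/-- The lattice point belongs to the dual lattice, that is, `2x/ε` and `2t/ε` are odd integers. -/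
def IsDualPoint {ε : ℝ} (z : fullLattice ε) : Prop :=
  IsOddInteger (2 * xCoord z / ε) ∧ IsOddInteger (2 * tCoord z / ε)

theorem fullLattice_right {ε : ℝ} (hε : ε ≠ 0) {q : ℝ × ℝ} (h : q ∈ fullLattice ε) :
    (q.1 + ε / 2, q.2 - ε / 2) ∈ fullLattice ε := by
  obtain ⟨⟨a, ha⟩, ⟨b, hb⟩, ⟨c, hc⟩⟩ := h
  refine ⟨⟨a + 1, ?_⟩, ⟨b - 1, ?_⟩, ⟨c, ?_⟩⟩
  · push_cast; rw [← ha]; field_simp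
  · push_cast; rw [← hb]; field_simp
  · rw [← hc]; ring

theorem fullLattice_left {ε : ℝ} (hε : ε ≠ 0) {q : ℝ × ℝ} (h : q ∈ fullLattice ε) :
    (q.1 - ε / 2, q.2 - ε / 2) ∈ fullLattice ε := by
  obtain ⟨⟨a, ha⟩, ⟨b, hb⟩, ⟨c, hc⟩⟩ := h
  refine ⟨⟨a - 1, ?_⟩, ⟨b - 1, ?_⟩, ⟨c - 1, ?_⟩⟩
  · push_cast; rw [← ha]; field_simp
  · push_cast; rw [← hb]; field_simp
  · push_cast; rw [← hc]; field_simp; ring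

/-- The lattice point `(x + ε/2, t - ε/2)`. -/
def shiftRight {ε : ℝ} (hε : ε ≠ 0) (z : fullLattice ε) : fullLattice ε :=
  ⟨(xCoord z + ε / 2, tCoord z - ε / 2), fullLattice_right hε z.2⟩

/-- The lattice point `(x - ε/2, t - ε/2)`. -/
def shiftLeft {ε : ℝ} (hε : ε ≠ 0) (z : fullLattice ε) : fullLattice ε :=
  ⟨(xCoord z - ε / 2, tCoord z - ε / 2), fullLattice_left hε z.2⟩

open Classical in
/-- The term `δ_{x0} δ_{t0}`. -/
def originDelta {ε : ℝ} (z : fullLattice ε) : ℂ :=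
  if xCoord z = 0 ∧ tCoord z = 0 then 1 else 0

/-- A pair `(A₁, A₂)` of complex-valued functions on the full lattice satisfies the
three axioms with lattice step `ε`, mass `m` and small imaginary mass `δ`. -/
structure SatisfiesAxioms (m ε : ℝ) (hε : ε ≠ 0) (δ : ℝ)
    (A : (fullLattice ε → ℂ) × (fullLattice ε → ℂ)) : Prop where
  axiom₁ : ∀ z : fullLattice ε, IsPrimalPoint z →
    A.1 z = 1 / (√(1 + m ^ 2 * ε ^ 2) : ℝ) *
      (A.1 (shiftRight hε z) + m * ε * A.2 (shiftRight hε z)) ∧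
    A.2 z = 1 / (√(1 + m ^ 2 * ε ^ 2) : ℝ) *
      (A.2 (shiftLeft hε z) - m * ε * A.1 (shiftLeft hε z)) + 2 * originDelta z
  axiom₂ : ∀ z : fullLattice ε, IsDualPoint z →
    A.1 z = 1 / (√(1 - δ ^ 2) : ℝ) *
      (A.1 (shiftRight hε z) - I * δ * A.2 (shiftRight hε z)) ∧
    A.2 z = 1 / (√(1 - δ ^ 2) : ℝ) *
      (A.2 (shiftLeft hε z) + I * δ * A.1 (shiftLeft hε z))
  axiom₃ : Summable fun z : {z : fullLattice ε // IsPrimalPoint z} =>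
    ‖A.1 z.1‖ ^ 2 + ‖A.2 z.1‖ ^ 2

/-- The pair `(A₁, A₂)` of functions `A_k(x, t, m, ε, δ)` satisfying the three axioms. -/
def axiomaticPair (m ε : ℝ) (hε : ε ≠ 0) (δ : ℝ) :
    (fullLattice ε → ℂ) × (fullLattice ε → ℂ) :=
  Classical.epsilon (SatisfiesAxioms m ε hε δ)

/-- The lattice propagator `Ã₁(x, t, m, ε) = lim_{δ ↘ 0} A₁(x, t, m, ε, δ)`. -/
def propagator₁ (m ε : ℝ) (hε : ε ≠ 0) (z : fullLattice ε) : ℂ :=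
  limUnder (𝓝[>] (0 : ℝ)) fun δ : ℝ => (axiomaticPair m ε hε δ).1 z

/-- The lattice propagator `Ã₂(x, t, m, ε) = lim_{δ ↘ 0} A₂(x, t, m, ε, δ)`. -/
def propagator₂ (m ε : ℝ) (hε : ε ≠ 0) (z : fullLattice ε) : ℂ :=
  limUnder (𝓝[>] (0 : ℝ)) fun δ : ℝ => (axiomaticPair m ε hε δ).2 z

/-- The frequency `ω_p`. -/
def omega (m ε p : ℝ) : ℝ :=
  1 / ε * Real.arccos (Real.cos (p * ε) / √(1 + m ^ 2 * ε ^ 2))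

open Classical in
/-- The sign in the formula for `Ã_k(x, t)`: it is `-1` if `t < 0` and `(x+t)/ε + k` is even,
and `1` otherwise. -/
def fourierSign (k : ℕ) {ε : ℝ} (z : fullLattice ε) : ℂ :=
  if tCoord z < 0 ∧ IsEvenInteger ((xCoord z + tCoord z) / ε + k) then -1 else 1

end

/-!
The values at the dual points are eliminated by means of the second axiom. With `μ = mε` and integer
coordinates `X = x/ε`, `T = t/ε` on `ε ℤ²`, what remains is the first-order system `SolvesReduced`,
which expresses the pair at time `T` through the pair at time `T - 1` and has a source at the origin.

*Uniqueness.* At each momentum the one-step transfer matrix of the system has determinant `1`. By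
Cayley–Hamilton, both components of a solution `f` of the homogeneous system satisfy
`f(X, T+1) + f(X, T-1) = n (f(X+1, T) + f(X-1, T)) + iκ f(X, T)` with real `n` and real `κ ≠ 0`
(`SolvesReduced.kleinGordon₁`, `SolvesReduced.kleinGordon₂`). Thus a square-summable `f` is an
eigenvector of a self-adjoint operator on `ℓ²(ℤ²)` with the non-real eigenvalue `iκ`, and hence
vanishes (`eq_zero_of_kleinGordon`).

*Existence.* Half the trace of the transfer matrix at momentum `p` is a number `w` in the upper
half-plane, so exactly one of the eigenvalues `w ± i√(1-w²)`, namely `λ = w - i√(1-w²)`, lies in the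
open unit disk (`norm_sub_I_mul_sqrt_lt_one`). The solution at momentum `p` follows the corresponding
eigenvector for `T ≥ 0` and the other one for `T < 0`; both parts are multiples of `λ^|T|`
(`mode_system`). The inverse Fourier transform is square-summable by Parseval's identity in `X` and
geometric decay in `T` (`summable_fourierIntegral_mode`).

*The limit.* The principal square root makes the Fourier modes jointly continuous in `p` and in
`δ ∈ [0, 1)`, also at `δ = 0`, where `w` is real and `|w| < 1`. So the integrals converge to their
values at `δ = 0` (`tendsto_fourierIntegral`), where `w = cos ω` and `λ = e^{-iω}`. This is the
asserted formula for `T ≥ 0`. For `T < 0` the integrand contains `e^{iωT}` instead of `e^{-iωT}`, and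
the substitution `p ↦ p + π`, under which `ω` becomes `π - ω`, leads to the asserted formula with its
sign (`fourierIntegral_of_neg`).
-/

noncomputable section

/-! ### Uniqueness: square-summable solutions of the lattice Klein–Gordon equation -/

section Uniqueness

variable {f : ℤ × ℤ → ℂ}

theorem summable_im_conj_mul_shift (hf : Summable fun z => ‖f z‖ ^ 2) (v : ℤ × ℤ) :
    Summable fun z => ((starRingEnd ℂ) (f z) * f (z + v)).im := by
  have hv : Summable fun z => ‖f (z + v)‖ ^ 2 :=
    (Equiv.addRight v).summable_iff.mpr hf
  refine Summable.of_norm_bounded (hf.add hv) fun z => ?_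
  refine (Complex.abs_im_le_norm _).trans ?_
  rw [norm_mul, RCLike.norm_conj]
  nlinarith [sq_nonneg (‖f z‖ - ‖f (z + v)‖), sq_nonneg ‖f z‖, sq_nonneg ‖f (z + v)‖]

/-- The sum of two opposite shifts is a symmetric operator, so its quadratic form is real. -/
theorem tsum_im_conj_mul_opposite_shifts (hf : Summable fun z => ‖f z‖ ^ 2) (v : ℤ × ℤ) :
    ∑' z, (((starRingEnd ℂ) (f z) * f (z + v)).im + ((starRingEnd ℂ) (f z) * f (z - v)).im) = 0 := by
  have h₁ := summable_im_conj_mul_shift hf v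
  have h₂ := summable_im_conj_mul_shift hf (-v)
  simp only [← sub_eq_add_neg] at h₂
  rw [h₁.tsum_add h₂,
    ← (Equiv.addRight v).tsum_eq fun z => ((starRingEnd ℂ) (f z) * f (z - v)).im,
    add_eq_zero_iff_eq_neg, ← tsum_neg]
  refine tsum_congr fun z => ?_
  simp only [Equiv.coe_addRight, add_sub_cancel_right, mul_im, conj_re, conj_im]
  ring

/-- A self-adjoint difference operator on `ℓ²(ℤ²)` has no non-real eigenvalue. -/
theorem eq_zero_of_kleinGordon (hf : Summable fun z => ‖f z‖ ^ 2) {n κ : ℝ} (hκ : κ ≠ 0)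
    (h : ∀ z, f (z + (0, 1)) + f (z - (0, 1)) =
      n * (f (z + (1, 0)) + f (z - (1, 0))) + I * κ * f z) (z : ℤ × ℤ) : f z = 0 := by
  -- The imaginary part of the equation multiplied by `conj (f z)`.
  have hpt : ∀ z, κ * ‖f z‖ ^ 2 =
      (((starRingEnd ℂ) (f z) * f (z + (0, 1))).im + ((starRingEnd ℂ) (f z) * f (z - (0, 1))).im) -
      n * (((starRingEnd ℂ) (f z) * f (z + (1, 0))).im +
        ((starRingEnd ℂ) (f z) * f (z - (1, 0))).im) := by
    intro z
    have hre := congrArg re (h z)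
    have him := congrArg im (h z)
    simp only [add_re, mul_re, ofReal_re, ofReal_im, zero_mul, sub_zero, I_re, I_im, mul_im,
      add_im, one_mul, zero_add, mul_zero, add_zero, zero_sub] at hre him
    rw [← Complex.normSq_eq_norm_sq, Complex.normSq_apply]
    simp only [mul_im, conj_re, conj_im]
    linear_combination (-(f z).re) * him + (f z).im * hre
  have hsum : ∑' z, κ * ‖f z‖ ^ 2 = 0 := by
    have s : ∀ v, Summable fun z => ((starRingEnd ℂ) (f z) * f (z + v)).im +
        ((starRingEnd ℂ) (f z) * f (z - v)).im := fun v =>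
      (summable_im_conj_mul_shift hf v).add (by
        simpa only [← sub_eq_add_neg] using summable_im_conj_mul_shift hf (-v))
    rw [tsum_congr hpt, (s (0, 1)).tsum_sub ((s (1, 0)).mul_left _), tsum_mul_left,
      tsum_im_conj_mul_opposite_shifts hf, tsum_im_conj_mul_opposite_shifts hf]
    simp
  rw [tsum_mul_left, mul_eq_zero, or_iff_right hκ] at hsum
  have h0 := (hasSum_zero_iff_of_nonneg fun z => sq_nonneg ‖f z‖).mp (hsum ▸ hf.hasSum)
  simpa using congrFun h0 z

end Uniqueness

/-! ### The reduced system on `ℤ²` -/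

/-- The product of the normalizing factors `1/√(1+μ²)` and `1/√(1-δ²)` of the two half-steps. -/
def normFactor (μ δ : ℝ) : ℝ := 1 / √(1 + μ ^ 2) * (1 / √(1 - δ ^ 2))

theorem normFactor_pos (μ : ℝ) {δ : ℝ} (hδ : 0 ≤ δ) (hδ₁ : δ < 1) : 0 < normFactor μ δ := by
  have : 0 < 1 - δ ^ 2 := by nlinarith
  unfold normFactor
  positivity

theorem normFactor_sq (μ : ℝ) {δ : ℝ} (hδ : 0 ≤ δ) (hδ₁ : δ < 1) :
    normFactor μ δ ^ 2 * ((1 + μ ^ 2) * (1 - δ ^ 2)) = 1 := by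
  have h : 0 < 1 - δ ^ 2 := by nlinarith
  have h' : 0 < 1 + μ ^ 2 := by positivity
  rw [normFactor, mul_pow, div_pow, div_pow, Real.sq_sqrt h.le, Real.sq_sqrt h'.le]
  field_simp

/-- The system obtained from the axioms by eliminating the values at the dual points, in the
integer coordinates `X = x/ε`, `T = t/ε` of the points of `ε ℤ²`. The mass enters through
`μ = m ε`, and the source at the origin has strength `r`. -/
structure SolvesReduced (μ δ : ℝ) (r : ℂ) (B₁ B₂ : ℤ → ℤ → ℂ) : Prop where
  eq₁ : ∀ X T, B₁ X T = normFactor μ δ * (B₁ (X + 1) (T - 1) - I * δ * B₂ (X + 1) (T - 1) +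
    μ * (B₂ X (T - 1) + I * δ * B₁ X (T - 1)))
  eq₂ : ∀ X T, B₂ X T = normFactor μ δ * (B₂ (X - 1) (T - 1) + I * δ * B₁ (X - 1) (T - 1) -
    μ * (B₁ X (T - 1) - I * δ * B₂ X (T - 1))) + r * (if X = 0 ∧ T = 0 then 1 else 0)

namespace SolvesReduced

variable {μ δ : ℝ} {r : ℂ} {B₁ B₂ C₁ C₂ : ℤ → ℤ → ℂ}

theorem sub (hB : SolvesReduced μ δ r B₁ B₂) (hC : SolvesReduced μ δ r C₁ C₂) :
    SolvesReduced μ δ 0 (fun X T => B₁ X T - C₁ X T) (fun X T => B₂ X T - C₂ X T) where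
  eq₁ X T := by rw [hB.eq₁, hC.eq₁]; ring
  eq₂ X T := by rw [hB.eq₂, hC.eq₂]; ring

/-- The Cayley–Hamilton theorem for the one-step transfer matrix, whose determinant is `1`:
the first component solves the Klein–Gordon equation. -/
theorem kleinGordon₁ (hB : SolvesReduced μ δ 0 B₁ B₂) (hδ : 0 ≤ δ) (hδ₁ : δ < 1) (X T : ℤ) :
    B₁ X (T + 1) + B₁ X (T - 1) = normFactor μ δ * (B₁ (X + 1) T + B₁ (X - 1) T) +
      I * (2 * μ * δ * normFactor μ δ : ℝ) * B₁ X T := by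
  have hn : (normFactor μ δ : ℂ) ^ 2 * ((1 + μ ^ 2) * (1 - δ ^ 2)) = 1 := by
    exact_mod_cast normFactor_sq μ hδ hδ₁
  have e := hB.eq₁ X (T + 1)
  rw [add_sub_cancel_right] at e
  have e₁ := hB.eq₁ (X - 1) T
  have e₂ := hB.eq₁ X T
  have e₃ := hB.eq₂ (X + 1) T
  have e₄ := hB.eq₂ X T
  simp only [sub_add_cancel, add_sub_cancel_right, zero_mul, add_zero] at e₁ e₂ e₃ e₄
  push_cast
  generalize (normFactor μ δ : ℂ) = n at *
  linear_combination e - n * e₁ - n * I * μ * δ * e₂ - I * δ * n * e₃ + n * μ * e₄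
    - B₁ X (T - 1) * hn - n ^ 2 * B₁ X (T - 1) * (δ ^ 2 * (1 + μ ^ 2)) * I_sq

theorem kleinGordon₂ (hB : SolvesReduced μ δ 0 B₁ B₂) (hδ : 0 ≤ δ) (hδ₁ : δ < 1) (X T : ℤ) :
    B₂ X (T + 1) + B₂ X (T - 1) = normFactor μ δ * (B₂ (X + 1) T + B₂ (X - 1) T) +
      I * (2 * μ * δ * normFactor μ δ : ℝ) * B₂ X T := by
  have hn : (normFactor μ δ : ℂ) ^ 2 * ((1 + μ ^ 2) * (1 - δ ^ 2)) = 1 := by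
    exact_mod_cast normFactor_sq μ hδ hδ₁
  have e := hB.eq₂ X (T + 1)
  rw [add_sub_cancel_right] at e
  have e₁ := hB.eq₂ (X + 1) T
  have e₂ := hB.eq₂ X T
  have e₃ := hB.eq₁ (X - 1) T
  have e₄ := hB.eq₁ X T
  simp only [sub_add_cancel, add_sub_cancel_right, zero_mul, add_zero] at e e₁ e₂ e₃ e₄
  push_cast
  generalize (normFactor μ δ : ℂ) = n at *
  linear_combination e - n * e₁ - n * I * μ * δ * e₂ + I * δ * n * e₃ - n * μ * e₄
    - B₂ X (T - 1) * hn - n ^ 2 * B₂ X (T - 1) * (δ ^ 2 * (1 + μ ^ 2)) * I_sq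

/-- The reduced system has at most one square-summable solution. -/
theorem unique (hμ : 0 < μ) (hδ : 0 < δ) (hδ₁ : δ < 1) (hB : SolvesReduced μ δ r B₁ B₂)
    (hC : SolvesReduced μ δ r C₁ C₂)
    (sB : Summable fun q : ℤ × ℤ => ‖B₁ q.1 q.2‖ ^ 2 + ‖B₂ q.1 q.2‖ ^ 2)
    (sC : Summable fun q : ℤ × ℤ => ‖C₁ q.1 q.2‖ ^ 2 + ‖C₂ q.1 q.2‖ ^ 2) :
    B₁ = C₁ ∧ B₂ = C₂ := by
  have hD := hB.sub hC
  have hκ : 2 * μ * δ * normFactor μ δ ≠ 0 := by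
    have := normFactor_pos μ hδ.le hδ₁
    positivity
  have bound : ∀ u v : ℂ, ‖u - v‖ ^ 2 ≤ 2 * (‖u‖ ^ 2 + ‖v‖ ^ 2) := fun u v => by
    have h := norm_sub_le u v
    nlinarith [norm_nonneg (u - v), sq_nonneg (‖u‖ - ‖v‖)]
  have key : ∀ D : ℤ → ℤ → ℂ,
      (∀ q : ℤ × ℤ, ‖D q.1 q.2‖ ^ 2 ≤ 2 * ((‖B₁ q.1 q.2‖ ^ 2 + ‖B₂ q.1 q.2‖ ^ 2) +
        (‖C₁ q.1 q.2‖ ^ 2 + ‖C₂ q.1 q.2‖ ^ 2))) →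
      (∀ X T, D X (T + 1) + D X (T - 1) = normFactor μ δ * (D (X + 1) T + D (X - 1) T) +
        I * (2 * μ * δ * normFactor μ δ : ℝ) * D X T) → ∀ X T, D X T = 0 := by
    intro D hb hKG X T
    refine eq_zero_of_kleinGordon (f := fun q => D q.1 q.2) (n := normFactor μ δ)
      (Summable.of_nonneg_of_le (fun _ => sq_nonneg _) hb ((sB.add sC).mul_left 2)) hκ
      (fun q => ?_) (X, T)
    simpa using hKG q.1 q.2
  constructor <;> funext X T
  · refine sub_eq_zero.mp (key (fun X T => B₁ X T - C₁ X T) (fun q => ?_)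
      (hD.kleinGordon₁ hδ.le hδ₁) X T)
    linarith [bound (B₁ q.1 q.2) (C₁ q.1 q.2), sq_nonneg ‖B₂ q.1 q.2‖, sq_nonneg ‖C₂ q.1 q.2‖]
  · refine sub_eq_zero.mp (key (fun X T => B₂ X T - C₂ X T) (fun q => ?_)
      (hD.kleinGordon₂ hδ.le hδ₁) X T)
    linarith [bound (B₂ q.1 q.2) (C₂ q.1 q.2), sq_nonneg ‖B₁ q.1 q.2‖, sq_nonneg ‖C₁ q.1 q.2‖]

end SolvesReduced

/-! ### The complex frequency -/

theorem one_sub_sq_mem_slitPlane {w : ℂ} (hw : 0 < w.im ∨ w.im = 0 ∧ |w.re| < 1) :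
    1 - w ^ 2 ∈ slitPlane := by
  rw [mem_slitPlane_iff]
  simp only [sub_re, one_re, sub_im, one_im, sq, mul_re, mul_im]
  rcases hw with h | ⟨h, h'⟩
  · by_cases hr : w.re = 0
    · left; rw [hr]; nlinarith
    · right
      have := mul_ne_zero hr h.ne'
      intro h0
      apply this
      linarith
  · left
    have := (sq_lt_one_iff_abs_lt_one w.re).mpr h'
    rw [h]; nlinarith

theorem re_sqrt_pos {z : ℂ} (hz : z ∈ slitPlane) : 0 < z.sqrt.re := by
  rw [Complex.sqrt, cpow_inv_two_re]
  apply Real.sqrt_pos.mpr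
  rcases mem_slitPlane_iff.mp hz with h | h
  · positivity
  · have := neg_abs_le z.re
    have := abs_re_lt_norm.mpr h
    linarith

theorem sq_sqrt (z : ℂ) : z.sqrt ^ 2 = z := cpow_ofNat_inv_pow z 2

/-- Of the two roots `w ± i√(1-w²)` of `λ + λ⁻¹ = 2w`, the one with the minus sign is the smaller
one if `w` lies in the upper half-plane. -/
theorem norm_sub_I_mul_sqrt_lt_one {w : ℂ} (hw : 0 < w.im) :
    ‖w - I * (1 - w ^ 2).sqrt‖ < 1 := by
  have hs := re_sqrt_pos (one_sub_sq_mem_slitPlane (.inl hw))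
  have hsq := sq_sqrt (1 - w ^ 2)
  generalize (1 - w ^ 2).sqrt = s at *
  have hprod : ‖w - I * s‖ * ‖w + I * s‖ = 1 := by
    rw [← norm_mul, show (w - I * s) * (w + I * s) = 1 by
      linear_combination (-s ^ 2) * I_sq + hsq, norm_one]
  have him : s.re * s.im = -(w.re * w.im) := by
    have := congrArg im hsq
    simp only [sq, mul_im, sub_im, one_im] at this
    linarith
  have hlt : ‖w - I * s‖ ^ 2 < ‖w + I * s‖ ^ 2 := by
    rw [← normSq_eq_norm_sq, ← normSq_eq_norm_sq, normSq_apply, normSq_apply]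
    simp only [sub_re, mul_re, I_re, I_im, sub_im, mul_im, add_re, add_im]
    have h : 0 < s.re * (w.im * s.re - w.re * s.im) := by
      have : s.re * (w.im * s.re - w.re * s.im) = w.im * (s.re ^ 2 + w.re ^ 2) := by
        linear_combination (-w.re) * him
      rw [this]; positivity
    have := pos_of_mul_pos_right h hs.le
    nlinarith
  have hlt' := lt_of_pow_lt_pow_left₀ 2 (norm_nonneg _) hlt
  by_contra! h
  nlinarith

/-- The cosine of the complex frequency: half the trace of the one-step transfer matrix at
momentum `p`. -/
def freqCos (μ δ p : ℝ) : ℂ := normFactor μ δ * (Real.cos p + I * μ * δ)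

/-- The sine of the complex frequency, with positive real part. -/
def freqSin (μ δ p : ℝ) : ℂ := (1 - freqCos μ δ p ^ 2).sqrt

/-- The eigenvalue of the one-step transfer matrix lying in the unit disk. -/
def decayFactor (μ δ p : ℝ) : ℂ := freqCos μ δ p - I * freqSin μ δ p

theorem freqCos_re (μ δ p : ℝ) : (freqCos μ δ p).re = normFactor μ δ * Real.cos p := by
  rw [freqCos, re_ofReal_mul, add_re, ofReal_re]
  simp [mul_assoc]

theorem freqCos_im (μ δ p : ℝ) : (freqCos μ δ p).im = normFactor μ δ * (μ * δ) := by
  simp [freqCos, mul_assoc]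

variable {μ δ : ℝ}

theorem normFactor_zero_lt_one (hμ : 0 < μ) : normFactor μ 0 < 1 := by
  have h := normFactor_sq μ le_rfl one_pos
  have h₀ := normFactor_pos μ le_rfl one_pos
  by_contra! h₁
  nlinarith [pow_pos hμ 2, one_le_pow₀ h₁ (n := 2)]

theorem one_sub_freqCos_sq_mem_slitPlane (hμ : 0 < μ) (hδ : 0 ≤ δ) (hδ₁ : δ < 1) (p : ℝ) :
    1 - freqCos μ δ p ^ 2 ∈ slitPlane := by
  apply one_sub_sq_mem_slitPlane
  rw [freqCos_im, freqCos_re]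
  have hn := normFactor_pos μ hδ hδ₁
  rcases hδ.eq_or_lt with rfl | h
  · refine .inr ⟨by ring, ?_⟩
    rw [abs_mul, abs_of_pos hn]
    nlinarith [Real.abs_cos_le_one p, normFactor_zero_lt_one hμ, abs_nonneg (Real.cos p)]
  · left; positivity

theorem freqSin_ne_zero (hμ : 0 < μ) (hδ : 0 ≤ δ) (hδ₁ : δ < 1) (p : ℝ) : freqSin μ δ p ≠ 0 := by
  intro h
  have := re_sqrt_pos (one_sub_freqCos_sq_mem_slitPlane hμ hδ hδ₁ p)
  rw [← freqSin, h] at this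
  exact lt_irrefl _ this

theorem freqSin_sq (μ δ p : ℝ) : freqSin μ δ p ^ 2 = 1 - freqCos μ δ p ^ 2 := sq_sqrt _

theorem norm_decayFactor_lt_one (hμ : 0 < μ) (hδ : 0 < δ) (hδ₁ : δ < 1) (p : ℝ) :
    ‖decayFactor μ δ p‖ < 1 := by
  apply norm_sub_I_mul_sqrt_lt_one
  rw [freqCos_im]
  have := normFactor_pos μ hδ.le hδ₁
  positivity

/-! ### Fourier modes -/

/-- The amplitude of `A₁` at momentum `p` and time `T`. -/
def mode₁ (μ δ : ℝ) (T : ℤ) (p : ℝ) : ℂ :=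
  decayFactor μ δ p ^ T.natAbs *
    (I * normFactor μ δ * (μ - I * δ * exp (I * p)) / freqSin μ δ p)

/-- The amplitude of `A₂` at momentum `p` and time `T`. It jumps by `2` at `T = 0`, where the
source is. -/
def mode₂ (μ δ : ℝ) (T : ℤ) (p : ℝ) : ℂ :=
  decayFactor μ δ p ^ T.natAbs *
    (normFactor μ δ * Real.sin p / freqSin μ δ p + if T < 0 then -1 else 1)

/-- `(iκ, s + σ)` is an eigenvector of the transfer matrix with eigenvalue `w - i s`, where
`κ = n (μ - iδe)`, `σ = n (e - e') / 2i` and `s² = 1 - w²`. Both signs of `s` are allowed. -/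
theorem transfer_eigenvector {n μ δ e e' s w : ℂ} (hn : n ^ 2 * ((1 + μ ^ 2) * (1 - δ ^ 2)) = 1)
    (he : e * e' = 1) (hw : w = n * ((e + e') / 2 + I * μ * δ)) (hs : s ^ 2 = 1 - w ^ 2) :
    n * (e * (I * n * (μ - I * δ * e)) - I * δ * (e * (s + n * ((e - e') / 2 * -I))) +
      μ * (s + n * ((e - e') / 2 * -I) + I * δ * (I * n * (μ - I * δ * e)))) =
      (w - I * s) * (I * n * (μ - I * δ * e)) ∧
    n * (e' * (s + n * ((e - e') / 2 * -I)) + I * δ * (e' * (I * n * (μ - I * δ * e))) -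
      μ * (I * n * (μ - I * δ * e) - I * δ * (s + n * ((e - e') / 2 * -I)))) =
      (w - I * s) * (s + n * ((e - e') / 2 * -I)) := by
  subst hw
  constructor
  · linear_combination n * (μ - I * δ * e) * s * I_sq
  · linear_combination I * hs - I * hn - (I * n ^ 2 + n ^ 2 * I ^ 3 * δ ^ 2) * he -
      (s * n * (e - e') / 2 + I * n ^ 2 * μ ^ 2 * δ ^ 2 + n ^ 2 * I * δ ^ 2) * I_sq

theorem exp_I_mul_mul_exp_neg (p : ℝ) : exp (I * p) * exp (-(I * p)) = 1 := by
  rw [← exp_add, add_neg_cancel, exp_zero]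

theorem ofReal_sin_eq (p : ℝ) :
    (Real.sin p : ℂ) = (exp (I * p) - exp (-(I * p))) / 2 * -I := by
  rw [ofReal_sin, Complex.sin, mul_comm I, neg_mul]
  ring

theorem ofReal_cos_eq (p : ℝ) : (Real.cos p : ℂ) = (exp (I * p) + exp (-(I * p))) / 2 := by
  rw [ofReal_cos, Complex.cos, mul_comm I, neg_mul]

/-- At each momentum, the modes solve the Fourier transform of the reduced system. -/
theorem mode_system (hμ : 0 < μ) (hδ : 0 ≤ δ) (hδ₁ : δ < 1) (T : ℤ) (p : ℝ) :
    mode₁ μ δ T p = normFactor μ δ * (exp (I * p) * mode₁ μ δ (T - 1) p -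
      I * δ * (exp (I * p) * mode₂ μ δ (T - 1) p) +
      μ * (mode₂ μ δ (T - 1) p + I * δ * mode₁ μ δ (T - 1) p)) ∧
    mode₂ μ δ T p = normFactor μ δ * (exp (-(I * p)) * mode₂ μ δ (T - 1) p +
      I * δ * (exp (-(I * p)) * mode₁ μ δ (T - 1) p) -
      μ * (mode₁ μ δ (T - 1) p - I * δ * mode₂ μ δ (T - 1) p)) + if T = 0 then 2 else 0 := by
  have hn : (normFactor μ δ : ℂ) ^ 2 * ((1 + μ ^ 2) * (1 - δ ^ 2)) = 1 := by
    exact_mod_cast normFactor_sq μ hδ hδ₁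
  have he := exp_I_mul_mul_exp_neg p
  have hw : freqCos μ δ p =
      normFactor μ δ * ((exp (I * p) + exp (-(I * p))) / 2 + I * μ * δ) := by
    rw [freqCos, ofReal_cos_eq]
  have hs := freqSin_sq μ δ p
  have hs0 := freqSin_ne_zero hμ hδ hδ₁ p
  have hl : (freqCos μ δ p - I * freqSin μ δ p) * (freqCos μ δ p + I * freqSin μ δ p) = 1 := by
    linear_combination (-freqSin μ δ p ^ 2) * I_sq + hs
  obtain ⟨h₁, h₂⟩ := transfer_eigenvector hn he hw hs
  obtain ⟨h₃, h₄⟩ := transfer_eigenvector hn he hw (s := -freqSin μ δ p) (by rw [neg_sq, hs])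
  simp only [mode₁, mode₂, decayFactor, ofReal_sin_eq]
  generalize (normFactor μ δ : ℂ) = n at *
  generalize freqCos μ δ p = w at *
  generalize freqSin μ δ p = s at *
  generalize exp (I * p) = e at *
  generalize exp (-(I * p)) = e' at *
  have hm : ∀ S, n * S / s + -1 = (-s + n * S) * s⁻¹ := fun S => by field_simp; ring
  have hp : ∀ S, n * S / s + 1 = (s + n * S) * s⁻¹ := fun S => by field_simp; ring
  rw [div_eq_mul_inv]
  -- Before the source the solution lies along the eigenvector with eigenvalue `w + i s = λ⁻¹`, after
  -- it along the one with eigenvalue `w - i s = λ`. The jump at `T = 0` is their difference `(0, 2)`.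
  rcases lt_trichotomy T 0 with hT | rfl | hT
  · have hN : (T - 1).natAbs = T.natAbs + 1 := by omega
    rw [hN, if_pos hT, if_pos (by omega), if_neg hT.ne, pow_succ]
    simp only [hm]
    generalize (w - I * s) ^ T.natAbs = q
    constructor
    · linear_combination (-q * (w - I * s) * s⁻¹) * h₃ - q * s⁻¹ * (I * n * (μ - I * δ * e)) * hl
    · linear_combination (-q * (w - I * s) * s⁻¹) * h₄ -
        q * s⁻¹ * (-s + n * ((e - e') / 2 * -I)) * hl
  · simp only [Int.natAbs_zero, pow_zero, lt_self_iff_false, if_false, if_true, zero_sub,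
      Int.natAbs_neg, Int.natAbs_one, pow_one]
    rw [if_pos (by norm_num), hm, hp]
    constructor
    · linear_combination (-(w - I * s) * s⁻¹) * h₃ - s⁻¹ * (I * n * (μ - I * δ * e)) * hl
    · linear_combination 2 * inv_mul_cancel₀ hs0 - (w - I * s) * s⁻¹ * h₄ -
        s⁻¹ * (-s + n * ((e - e') / 2 * -I)) * hl
  · have hN : T.natAbs = (T - 1).natAbs + 1 := by omega
    rw [hN, if_neg hT.not_gt, if_neg (by omega), if_neg hT.ne', pow_succ]
    simp only [hp]
    generalize (w - I * s) ^ (T - 1).natAbs = q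
    constructor
    · linear_combination (-q * s⁻¹) * h₁
    · linear_combination (-q * s⁻¹) * h₂

/-! ### Fourier integrals over the Brillouin zone -/

/-- The Fourier coefficient `(1/2π) ∫ e^{ipX} V(p) dp` over `-π ≤ p ≤ π`. -/
def fourierIntegral (V : ℝ → ℂ) (X : ℤ) : ℂ :=
  1 / (2 * Real.pi) * ∫ p in (-Real.pi)..Real.pi, exp (I * p * X) * V p

theorem fourierIntegral_add {V W : ℝ → ℂ} (hV : Continuous V) (hW : Continuous W) (X : ℤ) :
    fourierIntegral (fun p => V p + W p) X = fourierIntegral V X + fourierIntegral W X := by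
  simp only [fourierIntegral, mul_add]
  rw [intervalIntegral.integral_add (Continuous.intervalIntegrable (by fun_prop) _ _)
    (Continuous.intervalIntegrable (by fun_prop) _ _), mul_add]

theorem fourierIntegral_const_mul (c : ℂ) (V : ℝ → ℂ) (X : ℤ) :
    fourierIntegral (fun p => c * V p) X = c * fourierIntegral V X := by
  simp only [fourierIntegral, mul_left_comm _ c, intervalIntegral.integral_const_mul]

theorem fourierIntegral_sub {V W : ℝ → ℂ} (hV : Continuous V) (hW : Continuous W) (X : ℤ) :
    fourierIntegral (fun p => V p - W p) X = fourierIntegral V X - fourierIntegral W X := by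
  simp only [fourierIntegral, mul_sub]
  rw [intervalIntegral.integral_sub (Continuous.intervalIntegrable (by fun_prop) _ _)
    (Continuous.intervalIntegrable (by fun_prop) _ _), mul_sub]

theorem fourierIntegral_exp_mul (V : ℝ → ℂ) (X : ℤ) :
    fourierIntegral (fun p => exp (I * p) * V p) X = fourierIntegral V (X + 1) := by
  simp only [fourierIntegral, ← mul_assoc, ← exp_add]
  congr! 5
  push_cast; ring_nf

theorem fourierIntegral_exp_neg_mul (V : ℝ → ℂ) (X : ℤ) :
    fourierIntegral (fun p => exp (-(I * p)) * V p) X = fourierIntegral V (X - 1) := by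
  simp only [fourierIntegral, ← mul_assoc, ← exp_add]
  congr! 5
  push_cast; ring_nf

theorem fourierIntegral_const (c : ℂ) (X : ℤ) :
    fourierIntegral (fun _ => c) X = c * (if X = 0 then 1 else 0) := by
  have hpi : (Real.pi : ℂ) ≠ 0 := ofReal_ne_zero.mpr Real.pi_ne_zero
  rw [fourierIntegral, intervalIntegral.integral_mul_const]
  split_ifs with h
  · subst h
    simp only [Int.cast_zero, mul_zero, exp_zero, intervalIntegral.integral_const, real_smul]
    push_cast
    field_simp
    ring
  · have hX : I * X ≠ 0 := mul_ne_zero I_ne_zero (Int.cast_ne_zero.mpr h)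
    have : ∫ p in (-Real.pi)..Real.pi, exp (I * p * X) = 0 := by
      simp only [mul_right_comm I _ (X : ℂ)]
      rw [integral_exp_mul_complex hX, div_eq_zero_iff, sub_eq_zero, exp_eq_exp_iff_exists_int]
      refine .inl ⟨X, ?_⟩
      push_cast; ring
    rw [this]; ring

/-- Parseval's identity, with the `L²` norm of `V` estimated by its supremum. -/
theorem fourierIntegral_sq_summable {V : ℝ → ℂ} (hV : Continuous V) {C : ℝ}
    (hC : ∀ p ∈ Set.Icc (-Real.pi) Real.pi, ‖V p‖ ≤ C) :
    Summable (fun X => ‖fourierIntegral V X‖ ^ 2) ∧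
      ∑' X, ‖fourierIntegral V X‖ ^ 2 ≤ C ^ 2 := by
  have hab : -Real.pi < Real.pi := by linarith [Real.pi_pos]
  have hL2 : MeasureTheory.MemLp V 2
      (MeasureTheory.volume.restrict (Set.Ioc (-Real.pi) Real.pi)) := by
    refine MeasureTheory.MemLp.of_bound hV.aestronglyMeasurable C ?_
    refine MeasureTheory.ae_restrict_of_forall_mem measurableSet_Ioc fun p hp => ?_
    exact hC p (Set.Ioc_subset_Icc_self hp)
  have hcoef : ∀ X, fourierIntegral V X = fourierCoeffOn hab V (-X) := by
    intro X
    rw [fourierCoeffOn_eq_integral, fourierIntegral, neg_neg, real_smul]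
    congr 1
    · push_cast; ring
    · refine intervalIntegral.integral_congr fun p _ => ?_
      have hpi : (Real.pi : ℂ) ≠ 0 := ofReal_ne_zero.mpr Real.pi_ne_zero
      simp only [smul_eq_mul]
      rw [fourier_coe_apply]
      congr 2
      push_cast
      field_simp
      ring
  have hsum := hasSum_sq_fourierCoeffOn hab hL2
  rw [← (Equiv.neg ℤ).hasSum_iff] at hsum
  have hsum' : HasSum (fun X => ‖fourierIntegral V X‖ ^ 2)
      ((Real.pi - -Real.pi)⁻¹ • ∫ p in (-Real.pi)..Real.pi, ‖V p‖ ^ 2) := by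
    convert hsum using 2 with X
    simp [hcoef]
  refine ⟨hsum'.summable, hsum'.tsum_eq.trans_le ?_⟩
  have hle : ∫ p in (-Real.pi)..Real.pi, ‖V p‖ ^ 2 ≤ ∫ _p in (-Real.pi)..Real.pi, C ^ 2 := by
    refine intervalIntegral.integral_mono_on hab.le
      (Continuous.intervalIntegrable (by fun_prop) _ _) (by simp) fun p hp => ?_
    exact pow_le_pow_left₀ (norm_nonneg _) (hC p hp) 2
  rw [intervalIntegral.integral_const, smul_eq_mul] at hle
  rwa [smul_eq_mul, inv_mul_le_iff₀ (by linarith)]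

/-! ### Continuity of the modes in the momentum and the imaginary mass -/

theorem continuousOn_normFactor (μ : ℝ) : ContinuousOn (normFactor μ) (Set.Ico 0 1) := by
  unfold normFactor
  refine continuousOn_const.mul (continuousOn_const.div (by fun_prop) fun δ hδ => ?_)
  have : 0 < 1 - δ ^ 2 := by nlinarith [hδ.1, hδ.2]
  positivity

section Continuity

variable {Y : Type*} [TopologicalSpace Y] {d q : Y → ℝ}

theorem continuous_normFactor_comp (hd : Continuous d) (h : ∀ y, d y ∈ Set.Ico (0 : ℝ) 1) :
    Continuous fun y => normFactor μ (d y) :=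
  (continuousOn_normFactor μ).comp_continuous hd h

theorem continuous_freqCos_comp (hd : Continuous d) (hq : Continuous q)
    (h : ∀ y, d y ∈ Set.Ico (0 : ℝ) 1) : Continuous fun y => freqCos μ (d y) (q y) := by
  have := continuous_normFactor_comp (μ := μ) hd h
  unfold freqCos
  fun_prop

theorem continuous_freqSin_comp (hμ : 0 < μ) (hd : Continuous d) (hq : Continuous q)
    (h : ∀ y, d y ∈ Set.Ico (0 : ℝ) 1) : Continuous fun y => freqSin μ (d y) (q y) :=
  continuousOn_sqrt.comp_continuous
    (continuous_const.sub ((continuous_freqCos_comp hd hq h).pow 2))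
    fun y => one_sub_freqCos_sq_mem_slitPlane hμ (h y).1 (h y).2 _

theorem continuous_decayFactor_comp (hμ : 0 < μ) (hd : Continuous d) (hq : Continuous q)
    (h : ∀ y, d y ∈ Set.Ico (0 : ℝ) 1) : Continuous fun y => decayFactor μ (d y) (q y) :=
  (continuous_freqCos_comp hd hq h).sub
    (continuous_const.mul (continuous_freqSin_comp hμ hd hq h))

theorem continuous_mode₁_comp (hμ : 0 < μ) (hd : Continuous d) (hq : Continuous q)
    (h : ∀ y, d y ∈ Set.Ico (0 : ℝ) 1) (T : ℤ) : Continuous fun y => mode₁ μ (d y) T (q y) := by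
  have := continuous_normFactor_comp (μ := μ) hd h
  refine ((continuous_decayFactor_comp hμ hd hq h).pow _).mul
    (Continuous.div (by fun_prop) (continuous_freqSin_comp hμ hd hq h) fun y =>
      freqSin_ne_zero hμ (h y).1 (h y).2 _)

theorem continuous_mode₂_comp (hμ : 0 < μ) (hd : Continuous d) (hq : Continuous q)
    (h : ∀ y, d y ∈ Set.Ico (0 : ℝ) 1) (T : ℤ) : Continuous fun y => mode₂ μ (d y) T (q y) := by
  have := continuous_normFactor_comp (μ := μ) hd h
  refine ((continuous_decayFactor_comp hμ hd hq h).pow _).mul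
    (Continuous.add (Continuous.div (by fun_prop) (continuous_freqSin_comp hμ hd hq h) fun y =>
      freqSin_ne_zero hμ (h y).1 (h y).2 _) continuous_const)

end Continuity

theorem continuous_mode₁ (hμ : 0 < μ) (hδ : 0 ≤ δ) (hδ₁ : δ < 1) (T : ℤ) :
    Continuous (mode₁ μ δ T) :=
  continuous_mode₁_comp hμ continuous_const continuous_id (fun _ => ⟨hδ, hδ₁⟩) T

theorem continuous_mode₂ (hμ : 0 < μ) (hδ : 0 ≤ δ) (hδ₁ : δ < 1) (T : ℤ) :
    Continuous (mode₂ μ δ T) :=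
  continuous_mode₂_comp hμ continuous_const continuous_id (fun _ => ⟨hδ, hδ₁⟩) T

/-- The Fourier integral of a jointly continuous family converges as `δ ↘ 0`. -/
theorem tendsto_fourierIntegral {V : ℝ → ℝ → ℂ}
    (hV : ∀ d : ℝ × ℝ → ℝ, Continuous d → (∀ y, d y ∈ Set.Ico (0 : ℝ) 1) →
      Continuous fun y => V (d y) y.2) (X : ℤ) :
    Tendsto (fun δ => fourierIntegral (V δ) X) (𝓝[>] 0) (𝓝 (fourierIntegral (V 0) X)) := by
  -- Clamping `δ` to `[0, 1/2]` changes nothing near `0` and makes the integrand continuous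
  -- on the whole plane.
  let c : ℝ → ℝ := fun δ => max 0 (min δ (1 / 2))
  have hc : Continuous c := by fun_prop
  have hcont : Continuous fun δ => fourierIntegral (V (c δ)) X := by
    refine continuous_const.mul
      (intervalIntegral.continuous_parametric_intervalIntegral_of_continuous' ?_ _ _)
    refine Continuous.mul (by fun_prop) (hV (fun y => c y.1) (by fun_prop) fun y => ⟨?_, ?_⟩)
    · exact le_max_left _ _
    · exact max_lt one_pos ((min_le_right _ _).trans_lt (by norm_num))
  have h0 : c 0 = 0 := by simp [c]
  have hlim := (hcont.tendsto 0).mono_left (nhdsWithin_le_nhds (s := Set.Ioi 0))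
  rw [h0] at hlim
  refine hlim.congr' ?_
  filter_upwards [Ioo_mem_nhdsGT (show (0 : ℝ) < 1 / 2 by norm_num)] with δ hδ
  have : c δ = δ := by
    simp only [c]
    rw [min_eq_left hδ.2.le, max_eq_right hδ.1.le]
  rw [this]

/-! ### The square-summable solution of the reduced system -/

theorem fourierIntegral_mode_solves (hμ : 0 < μ) (hδ : 0 ≤ δ) (hδ₁ : δ < 1) :
    SolvesReduced μ δ 2 (fun X T => fourierIntegral (mode₁ μ δ T) X)
      (fun X T => fourierIntegral (mode₂ μ δ T) X) where
  eq₁ X T := by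
    have c₁ := continuous_mode₁ hμ hδ hδ₁ (T - 1)
    have c₂ := continuous_mode₂ hμ hδ hδ₁ (T - 1)
    rw [funext fun p => (mode_system hμ hδ hδ₁ T p).1]
    rw [fourierIntegral_const_mul, fourierIntegral_add (by fun_prop) (by fun_prop),
      fourierIntegral_sub (by fun_prop) (by fun_prop), fourierIntegral_const_mul,
      fourierIntegral_exp_mul, fourierIntegral_exp_mul, fourierIntegral_const_mul,
      fourierIntegral_add (by fun_prop) (by fun_prop), fourierIntegral_const_mul]
  eq₂ X T := by
    have c₁ := continuous_mode₁ hμ hδ hδ₁ (T - 1)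
    have c₂ := continuous_mode₂ hμ hδ hδ₁ (T - 1)
    rw [funext fun p => (mode_system hμ hδ hδ₁ T p).2]
    rw [fourierIntegral_add (by fun_prop) (by fun_prop), fourierIntegral_const,
      fourierIntegral_const_mul, fourierIntegral_sub (by fun_prop) (by fun_prop),
      fourierIntegral_add (by fun_prop) (by fun_prop), fourierIntegral_const_mul,
      fourierIntegral_exp_neg_mul, fourierIntegral_exp_neg_mul, fourierIntegral_const_mul,
      fourierIntegral_sub (by fun_prop) (by fun_prop), fourierIntegral_const_mul]
    congr 1
    by_cases hX : X = 0 <;> by_cases hT : T = 0 <;> simp [hX, hT]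

/-- Fourier integrals of modes that decay geometrically in time, uniformly in the momentum, are
square-summable over `ℤ²`. -/
theorem summable_fourierIntegral_sq {V : ℤ → ℝ → ℂ} (hV : ∀ T, Continuous (V T)) {C ρ : ℝ}
    (hρ : 0 ≤ ρ) (hρ₁ : ρ < 1)
    (hC : ∀ T, ∀ p ∈ Set.Icc (-Real.pi) Real.pi, ‖V T p‖ ≤ ρ ^ T.natAbs * C) :
    Summable fun q : ℤ × ℤ => ‖fourierIntegral (V q.2) q.1‖ ^ 2 := by
  have key : Summable fun q : ℤ × ℤ => ‖fourierIntegral (V q.1) q.2‖ ^ 2 := by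
    rw [summable_prod_of_nonneg fun _ => sq_nonneg _]
    refine ⟨fun T => (fourierIntegral_sq_summable (hV T) (hC T)).1,
      Summable.of_nonneg_of_le (fun _ => tsum_nonneg fun _ => sq_nonneg _)
        (fun T => (fourierIntegral_sq_summable (hV T) (hC T)).2) ?_⟩
    have hgeo : Summable fun T : ℤ => (ρ ^ 2) ^ T.natAbs := by
      have h := summable_geometric_of_lt_one (sq_nonneg ρ) (by nlinarith : ρ ^ 2 < 1)
      exact Summable.of_nat_of_neg (by simpa using h) (by simpa using h)
    refine (summable_congr fun T => ?_).mpr (hgeo.mul_right (C ^ 2))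
    rw [mul_pow, ← pow_mul, ← pow_mul, mul_comm 2]
  exact (Equiv.prodComm ℤ ℤ).summable_iff.mpr key

/-- By compactness the decay is uniform in the momentum. -/
theorem exists_decay_bound (hμ : 0 < μ) (hδ : 0 < δ) (hδ₁ : δ < 1) :
    ∃ ρ : ℝ, 0 ≤ ρ ∧ ρ < 1 ∧ ∀ p ∈ Set.Icc (-Real.pi) Real.pi, ‖decayFactor μ δ p‖ ≤ ρ := by
  have hcont : Continuous fun p => ‖decayFactor μ δ p‖ :=
    (continuous_decayFactor_comp hμ continuous_const continuous_id fun _ => ⟨hδ.le, hδ₁⟩).norm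
  obtain ⟨p₀, -, h⟩ := isCompact_Icc.exists_isMaxOn
    (Set.nonempty_Icc.mpr (by linarith [Real.pi_pos] : -Real.pi ≤ Real.pi)) hcont.continuousOn
  exact ⟨_, norm_nonneg _, norm_decayFactor_lt_one hμ hδ hδ₁ p₀, fun p hp => h hp⟩

/-- A continuous function of momentum, multiplied by powers of the decay factor, gives a
square-summable function on `ℤ²`. The function may depend on the sign of time. -/
theorem summable_fourierIntegral_decay (hμ : 0 < μ) (hδ : 0 < δ) (hδ₁ : δ < 1)
    {W₀ W₁ : ℝ → ℂ} (h₀ : Continuous W₀) (h₁ : Continuous W₁) :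
    Summable fun q : ℤ × ℤ => ‖fourierIntegral (fun p =>
      decayFactor μ δ p ^ q.2.natAbs * (if q.2 < 0 then W₀ p else W₁ p)) q.1‖ ^ 2 := by
  obtain ⟨ρ, hρ, hρ₁, hd⟩ := exists_decay_bound hμ hδ hδ₁
  obtain ⟨C₀, hC₀⟩ := isCompact_Icc.exists_bound_of_continuousOn (h₀.continuousOn
    (s := Set.Icc (-Real.pi) Real.pi))
  obtain ⟨C₁, hC₁⟩ := isCompact_Icc.exists_bound_of_continuousOn (h₁.continuousOn
    (s := Set.Icc (-Real.pi) Real.pi))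
  have hcont : Continuous (decayFactor μ δ) :=
    continuous_decayFactor_comp hμ continuous_const continuous_id fun _ => ⟨hδ.le, hδ₁⟩
  refine summable_fourierIntegral_sq (V := fun T p => decayFactor μ δ p ^ T.natAbs *
    (if T < 0 then W₀ p else W₁ p)) (C := max C₀ C₁) (fun T => ?_) hρ hρ₁ fun T p hp => ?_
  · split_ifs <;> fun_prop
  · rw [norm_mul, norm_pow]
    refine mul_le_mul (pow_le_pow_left₀ (norm_nonneg _) (hd p hp) _) ?_ (norm_nonneg _)
      (pow_nonneg hρ _)
    split_ifs
    · exact (hC₀ p hp).trans (le_max_left _ _)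
    · exact (hC₁ p hp).trans (le_max_right _ _)

theorem summable_fourierIntegral_mode (hμ : 0 < μ) (hδ : 0 < δ) (hδ₁ : δ < 1) :
    Summable fun q : ℤ × ℤ => ‖fourierIntegral (mode₁ μ δ q.2) q.1‖ ^ 2 +
      ‖fourierIntegral (mode₂ μ δ q.2) q.1‖ ^ 2 := by
  have hs : Continuous (freqSin μ δ) :=
    continuous_freqSin_comp hμ continuous_const continuous_id fun _ => ⟨hδ.le, hδ₁⟩
  have hs0 := freqSin_ne_zero hμ hδ.le hδ₁
  have h₁ : Continuous fun p : ℝ =>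
      I * normFactor μ δ * (μ - I * δ * exp (I * p)) / freqSin μ δ p :=
    Continuous.div (by fun_prop) hs hs0
  have h₂ : Continuous fun p : ℝ => (normFactor μ δ * Real.sin p / freqSin μ δ p : ℂ) :=
    Continuous.div (by fun_prop) hs hs0
  refine Summable.add ?_ ?_
  · refine (summable_congr fun q => ?_).mpr (summable_fourierIntegral_decay hμ hδ hδ₁ h₁ h₁)
    simp only [ite_self]
    rfl
  · refine (summable_congr fun q => ?_).mpr (summable_fourierIntegral_decay hμ hδ hδ₁
      (h₂.add (continuous_const (y := -1))) (h₂.add (continuous_const (y := 1))))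
    have : mode₂ μ δ q.2 = fun p => decayFactor μ δ p ^ q.2.natAbs *
        (if q.2 < 0 then normFactor μ δ * Real.sin p / freqSin μ δ p + -1
          else normFactor μ δ * Real.sin p / freqSin μ δ p + 1) := by
      funext p
      rw [mode₂]
      split_ifs <;> rfl
    rw [this]
    rfl

/-! ### The limit of zero imaginary mass -/

/-- The frequency at momentum `p` for the lattice step `1`. -/
def latticeFreq (μ p : ℝ) : ℝ := Real.arccos (Real.cos p / √(1 + μ ^ 2))

theorem normFactor_zero (μ : ℝ) : normFactor μ 0 = 1 / √(1 + μ ^ 2) := by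
  simp [normFactor]

theorem abs_cos_div_sqrt_le_one (μ p : ℝ) : |Real.cos p / √(1 + μ ^ 2)| ≤ 1 := by
  have h : 1 ≤ √(1 + μ ^ 2) := Real.one_le_sqrt.mpr (by nlinarith [sq_nonneg μ])
  rw [abs_div, abs_of_pos (zero_lt_one.trans_le h), div_le_one (zero_lt_one.trans_le h)]
  exact (Real.abs_cos_le_one p).trans h

theorem freqCos_zero (μ p : ℝ) : freqCos μ 0 p = (Real.cos (latticeFreq μ p) : ℝ) := by
  have h := abs_le.mp (abs_cos_div_sqrt_le_one μ p)
  rw [latticeFreq, Real.cos_arccos h.1 h.2, freqCos, normFactor_zero]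
  push_cast
  ring

theorem freqSin_zero_eq_sin (μ p : ℝ) : freqSin μ 0 p = (Real.sin (latticeFreq μ p) : ℝ) := by
  have h0 : 0 ≤ Real.sin (latticeFreq μ p) :=
    Real.sin_nonneg_of_nonneg_of_le_pi (Real.arccos_nonneg _) (Real.arccos_le_pi _)
  have h : (1 : ℂ) - freqCos μ 0 p ^ 2 = (Real.sin (latticeFreq μ p) ^ 2 : ℝ) := by
    rw [freqCos_zero, Real.sin_sq]
    push_cast
    ring
  rw [freqSin, h, sqrt_of_nonneg (by exact_mod_cast sq_nonneg (Real.sin (latticeFreq μ p))),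
    ofReal_re, Real.sqrt_sq h0]

theorem freqSin_zero (μ p : ℝ) :
    freqSin μ 0 p = normFactor μ 0 * (√(μ ^ 2 + Real.sin p ^ 2) : ℝ) := by
  have h' : 0 < 1 + μ ^ 2 := by positivity
  rw [freqSin_zero_eq_sin, latticeFreq, Real.sin_arccos, normFactor_zero, ← ofReal_mul,
    show 1 - (Real.cos p / √(1 + μ ^ 2)) ^ 2 = (μ ^ 2 + Real.sin p ^ 2) / (1 + μ ^ 2) by
      rw [div_pow, Real.sq_sqrt h'.le, Real.sin_sq]
      field_simp
      ring,
    Real.sqrt_div (by positivity)]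
  congr 1
  ring

theorem decayFactor_zero (μ p : ℝ) : decayFactor μ 0 p = exp (-(I * latticeFreq μ p)) := by
  rw [decayFactor, freqCos_zero, freqSin_zero_eq_sin, ofReal_cos_eq, ofReal_sin_eq]
  linear_combination (exp (I * latticeFreq μ p) - exp (-(I * latticeFreq μ p))) / 2 * I_sq

theorem mode₁_zero (μ : ℝ) (T : ℤ) (p : ℝ) :
    mode₁ μ 0 T p = exp (-(I * latticeFreq μ p)) ^ T.natAbs *
      (I * μ * (1 / (√(μ ^ 2 + Real.sin p ^ 2) : ℝ))) := by
  have hn : (normFactor μ 0 : ℂ) ≠ 0 := ofReal_ne_zero.mpr (normFactor_pos μ le_rfl one_pos).ne'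
  rw [mode₁, decayFactor_zero, freqSin_zero, ofReal_zero, mul_zero, zero_mul, sub_zero,
    mul_right_comm, mul_comm (normFactor μ 0 : ℂ), mul_div_mul_right _ _ hn, mul_one_div]

theorem mode₂_zero (μ : ℝ) (T : ℤ) (p : ℝ) :
    mode₂ μ 0 T p = exp (-(I * latticeFreq μ p)) ^ T.natAbs *
      ((Real.sin p / √(μ ^ 2 + Real.sin p ^ 2) : ℝ) + if T < 0 then -1 else 1) := by
  have hn : (normFactor μ 0 : ℂ) ≠ 0 := ofReal_ne_zero.mpr (normFactor_pos μ le_rfl one_pos).ne'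
  rw [mode₂, decayFactor_zero, freqSin_zero, mul_div_mul_left _ _ hn, ofReal_div]

theorem latticeFreq_add_pi (μ p : ℝ) : latticeFreq μ (p + Real.pi) = Real.pi - latticeFreq μ p := by
  rw [latticeFreq, Real.cos_add_pi, neg_div, Real.arccos_neg, latticeFreq]

theorem latticeFreq_periodic (μ : ℝ) :
    Function.Periodic (latticeFreq μ) (2 * Real.pi) := fun p => by
  rw [latticeFreq, Real.cos_add_two_pi, latticeFreq]

theorem exp_I_mul_pi_mul_int (n : ℤ) : exp (I * Real.pi * n) = (-1) ^ n := by
  rw [mul_comm, exp_int_mul, mul_comm, exp_pi_mul_I]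

theorem fourierIntegral_of_nonneg {W : ℝ → ℂ} {T : ℤ} (hT : 0 ≤ T) (X : ℤ) :
    fourierIntegral (fun p => exp (-(I * latticeFreq μ p)) ^ T.natAbs * W p) X =
      1 / (2 * Real.pi) *
        ∫ p in (-Real.pi)..Real.pi, exp (I * p * X - I * latticeFreq μ p * T) * W p := by
  rw [fourierIntegral]
  have : (T : ℂ) = T.natAbs := by rw [← Int.cast_natCast, Int.natAbs_of_nonneg hT]
  congr 1
  refine intervalIntegral.integral_congr fun p _ => ?_
  rw [← mul_assoc, ← exp_nat_mul, ← exp_add, this]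
  ring_nf

/-- Moving the momentum by `π` replaces the frequency `ω` by `π - ω`. This turns a wave of
frequency `-ω` into one of frequency `ω`, at the cost of the sign `(-1)^(X+T)`. -/
theorem fourierIntegral_of_neg {W : ℝ → ℂ} (hW : Function.Periodic W (2 * Real.pi))
    {T : ℤ} (hT : T < 0) (X : ℤ) :
    fourierIntegral (fun p => exp (-(I * latticeFreq μ p)) ^ T.natAbs * W (p + Real.pi)) X =
      (-1) ^ (X + T) * (1 / (2 * Real.pi) *
        ∫ p in (-Real.pi)..Real.pi, exp (I * p * X - I * latticeFreq μ p * T) * W p) := by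
  set h : ℝ → ℂ := fun p => exp (I * p * X - I * latticeFreq μ p * T) * W p with hh
  have hper : Function.Periodic h (2 * Real.pi) := fun p => by
    simp only [hh]
    rw [hW, latticeFreq_periodic]
    congr 1
    rw [exp_eq_exp_iff_exists_int]
    refine ⟨X, ?_⟩
    push_cast
    ring
  have hshift : ∫ p in (-Real.pi)..Real.pi, h p = ∫ p in (-Real.pi)..Real.pi, h (p + Real.pi) := by
    rw [intervalIntegral.integral_comp_add_right]
    have := hper.intervalIntegral_add_eq (-Real.pi) 0
    convert this using 2 <;> ring
  have hpt : ∀ p : ℝ, exp (I * p * X) * (exp (-(I * latticeFreq μ p)) ^ T.natAbs * W (p + Real.pi)) =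
      (-1) ^ (X + T) * h (p + Real.pi) := fun p => by
    have hN : (T : ℂ) = -(T.natAbs : ℂ) := by
      rw [← Int.cast_natCast, Int.ofNat_natAbs_of_nonpos hT.le]; push_cast; ring
    simp only [hh]
    rw [latticeFreq_add_pi, ← mul_assoc, ← mul_assoc, ← exp_nat_mul, ← exp_add,
      ← exp_I_mul_pi_mul_int, ← exp_add]
    congr 1
    rw [exp_eq_exp_iff_exists_int]
    refine ⟨-X, ?_⟩
    push_cast
    rw [hN]
    ring
  simp only [fourierIntegral, hpt]
  rw [hshift, intervalIntegral.integral_const_mul, mul_left_comm]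

theorem fourierIntegral_mode₁_zero (μ : ℝ) (X T : ℤ) :
    fourierIntegral (mode₁ μ 0 T) X = (if T < 0 then (-1) ^ (X + T) else 1) *
      (I * μ / (2 * Real.pi) * ∫ p in (-Real.pi)..Real.pi,
        exp (I * p * X - I * latticeFreq μ p * T) / (√(μ ^ 2 + Real.sin p ^ 2) : ℝ)) := by
  have hmode : mode₁ μ 0 T = fun p => I * μ * (exp (-(I * latticeFreq μ p)) ^ T.natAbs *
      (1 / (√(μ ^ 2 + Real.sin p ^ 2) : ℝ))) := funext fun p => by
    rw [mode₁_zero]; ring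
  rw [hmode, fourierIntegral_const_mul]
  split_ifs with hT
  · have h := fourierIntegral_of_neg (μ := μ)
      (W := fun p => 1 / ((√(μ ^ 2 + Real.sin p ^ 2) : ℝ) : ℂ))
      (fun p => by simp only [Real.sin_add_two_pi]) hT X
    simp only [Real.sin_add_pi, neg_sq] at h
    rw [h]
    simp only [mul_one_div]
    ring
  · rw [fourierIntegral_of_nonneg (not_lt.mp hT)]
    simp only [mul_one_div]
    ring

theorem fourierIntegral_mode₂_zero (μ : ℝ) (X T : ℤ) :
    fourierIntegral (mode₂ μ 0 T) X = (if T < 0 then -(-1) ^ (X + T) else 1) *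
      (1 / (2 * Real.pi) * ∫ p in (-Real.pi)..Real.pi,
        (1 + (Real.sin p / √(μ ^ 2 + Real.sin p ^ 2) : ℝ)) *
          exp (I * p * X - I * latticeFreq μ p * T)) := by
  simp only [mul_comm (1 + _) (exp _)]
  split_ifs with hT
  · have h := fourierIntegral_of_neg (μ := μ)
      (W := fun p => 1 + ((Real.sin p / √(μ ^ 2 + Real.sin p ^ 2) : ℝ) : ℂ))
      (fun p => by simp only [Real.sin_add_two_pi]) hT X
    simp only [Real.sin_add_pi, neg_sq] at h
    rw [neg_mul, ← h, ← neg_one_mul, ← fourierIntegral_const_mul]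
    congr 1
    funext p
    rw [mode₂_zero, if_pos hT, neg_div, ofReal_neg]
    ring
  · rw [← fourierIntegral_of_nonneg (not_lt.mp hT)]
    rw [one_mul]
    congr 1
    funext p
    rw [mode₂_zero, if_neg hT, add_comm]

/-! ### Integer coordinates on the lattice -/

section Coordinates

variable {ε : ℝ}

theorem primalPoint_mem (hε : ε ≠ 0) (X T : ℤ) : ((ε * X, ε * T) : ℝ × ℝ) ∈ fullLattice ε := by
  refine ⟨⟨2 * X, ?_⟩, ⟨2 * T, ?_⟩, ⟨X + T, ?_⟩⟩ <;> push_cast <;> field_simp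

theorem dualPoint_mem (hε : ε ≠ 0) (X T : ℤ) :
    ((ε * X + ε / 2, ε * T + ε / 2) : ℝ × ℝ) ∈ fullLattice ε := by
  refine ⟨⟨2 * X + 1, ?_⟩, ⟨2 * T + 1, ?_⟩, ⟨X + T + 1, ?_⟩⟩ <;>
    (push_cast; field_simp)
  ring

/-- The point `(εX, εT)` of `ε ℤ²`. -/
def primalPoint (hε : ε ≠ 0) (X T : ℤ) : fullLattice ε := ⟨(ε * X, ε * T), primalPoint_mem hε X T⟩

/-- The point `(εX + ε/2, εT + ε/2)` of the dual lattice. -/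
def dualPoint (hε : ε ≠ 0) (X T : ℤ) : fullLattice ε :=
  ⟨(ε * X + ε / 2, ε * T + ε / 2), dualPoint_mem hε X T⟩

theorem isPrimalPoint_primalPoint (hε : ε ≠ 0) (X T : ℤ) : IsPrimalPoint (primalPoint hε X T) := by
  refine ⟨⟨2 * X, even_two_mul X, ?_⟩, ⟨2 * T, even_two_mul T, ?_⟩⟩ <;>
    simp only [xCoord, tCoord, primalPoint] <;> push_cast <;> field_simp

theorem isDualPoint_dualPoint (hε : ε ≠ 0) (X T : ℤ) : IsDualPoint (dualPoint hε X T) := by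
  refine ⟨⟨2 * X + 1, odd_two_mul_add_one X, ?_⟩, ⟨2 * T + 1, odd_two_mul_add_one T, ?_⟩⟩ <;>
    simp only [xCoord, tCoord, dualPoint] <;> push_cast <;> field_simp

theorem IsPrimalPoint.exists_eq {z : fullLattice ε} (hz : IsPrimalPoint z) (hε : ε ≠ 0) :
    ∃ X T, z = primalPoint hε X T := by
  obtain ⟨⟨a, ⟨X, hX⟩, ha⟩, b, ⟨T, hT⟩, hb⟩ := hz
  refine ⟨X, T, Subtype.ext (Prod.ext ?_ ?_)⟩
  · rw [hX] at ha; push_cast at ha; field_simp at ha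
    simp only [primalPoint]; linarith
  · rw [hT] at hb; push_cast at hb; field_simp at hb
    simp only [primalPoint]; linarith

theorem IsDualPoint.exists_eq {z : fullLattice ε} (hz : IsDualPoint z) (hε : ε ≠ 0) :
    ∃ X T, z = dualPoint hε X T := by
  obtain ⟨⟨a, ⟨X, hX⟩, ha⟩, b, ⟨T, hT⟩, hb⟩ := hz
  refine ⟨X, T, Subtype.ext (Prod.ext ?_ ?_)⟩
  · rw [hX] at ha; push_cast at ha; field_simp at ha
    simp only [dualPoint]; linarith
  · rw [hT] at hb; push_cast at hb; field_simp at hb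
    simp only [dualPoint]; linarith

/-- Since `2x/ε + 2t/ε` is even, `2x/ε` and `2t/ε` have the same parity. -/
theorem isPrimalPoint_or_isDualPoint (z : fullLattice ε) :
    IsPrimalPoint z ∨ IsDualPoint z := by
  obtain ⟨⟨a, ha⟩, ⟨b, hb⟩, ⟨c, hc⟩⟩ := z.2
  have hab : a + b = 2 * c := by
    have : (a : ℝ) + b = 2 * c := by rw [← ha, ← hb, ← hc]; ring
    exact_mod_cast this
  rcases Int.even_or_odd a with h | h
  · refine .inl ⟨⟨a, h, ha⟩, ⟨b, ?_, hb⟩⟩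
    rw [show b = 2 * c - a by omega]
    exact (even_two_mul c).sub h
  · refine .inr ⟨⟨a, h, ha⟩, ⟨b, ?_, hb⟩⟩
    rw [show b = 2 * c - a by omega]
    exact (even_two_mul c).sub_odd h

theorem not_isPrimalPoint_dualPoint (hε : ε ≠ 0) (X T : ℤ) :
    ¬ IsPrimalPoint (dualPoint hε X T) := by
  rintro ⟨⟨a, ha, h⟩, -⟩
  obtain ⟨⟨b, hb, h'⟩, -⟩ := isDualPoint_dualPoint hε X T
  have : a = b := by exact_mod_cast h.symm.trans h'
  exact Int.not_even_iff_odd.mpr hb (this ▸ ha)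

theorem shiftRight_dualPoint (hε : ε ≠ 0) (X T : ℤ) :
    shiftRight hε (dualPoint hε X T) = primalPoint hε (X + 1) T := by
  refine Subtype.ext (Prod.ext ?_ ?_) <;> simp only [shiftRight, dualPoint, primalPoint] <;>
    (push_cast; ring)

theorem shiftLeft_dualPoint (hε : ε ≠ 0) (X T : ℤ) :
    shiftLeft hε (dualPoint hε X T) = primalPoint hε X T := by
  refine Subtype.ext (Prod.ext ?_ ?_) <;> simp only [shiftLeft, dualPoint, primalPoint] <;> ring

theorem shiftRight_primalPoint (hε : ε ≠ 0) (X T : ℤ) :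
    shiftRight hε (primalPoint hε X T) = dualPoint hε X (T - 1) := by
  refine Subtype.ext (Prod.ext ?_ ?_) <;> simp only [shiftRight, dualPoint, primalPoint]
  push_cast
  ring

theorem shiftLeft_primalPoint (hε : ε ≠ 0) (X T : ℤ) :
    shiftLeft hε (primalPoint hε X T) = dualPoint hε (X - 1) (T - 1) := by
  refine Subtype.ext (Prod.ext ?_ ?_) <;> simp only [shiftLeft, dualPoint, primalPoint] <;>
    (push_cast; ring)

theorem floor_xCoord_primalPoint (hε : ε ≠ 0) (X T : ℤ) :
    ⌊xCoord (primalPoint hε X T) / ε⌋ = X := by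
  simp only [xCoord, primalPoint]
  rw [mul_div_cancel_left₀ _ hε, Int.floor_intCast]

theorem floor_tCoord_primalPoint (hε : ε ≠ 0) (X T : ℤ) :
    ⌊tCoord (primalPoint hε X T) / ε⌋ = T := by
  simp only [tCoord, primalPoint]
  rw [mul_div_cancel_left₀ _ hε, Int.floor_intCast]

theorem floor_mul_add_half_div (hε : ε ≠ 0) (X : ℤ) : ⌊(ε * X + ε / 2) / ε⌋ = X := by
  rw [show (ε * X + ε / 2) / ε = X + 1 / 2 by field_simp, Int.floor_intCast_add,
    show ⌊(1 / 2 : ℝ)⌋ = 0 by norm_num, add_zero]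

theorem originDelta_primalPoint (hε : ε ≠ 0) (X T : ℤ) :
    originDelta (primalPoint hε X T) = if X = 0 ∧ T = 0 then 1 else 0 := by
  simp [originDelta, xCoord, tCoord, primalPoint, hε]

/-- Integer coordinates on `ε ℤ²`. -/
def primalEquiv (hε : ε ≠ 0) : ℤ × ℤ ≃ {z : fullLattice ε // IsPrimalPoint z} where
  toFun q := ⟨primalPoint hε q.1 q.2, isPrimalPoint_primalPoint hε q.1 q.2⟩
  invFun z := (⌊xCoord z.1 / ε⌋, ⌊tCoord z.1 / ε⌋)
  left_inv q := Prod.ext (floor_xCoord_primalPoint hε _ _) (floor_tCoord_primalPoint hε _ _)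
  right_inv z := by
    obtain ⟨z, hz⟩ := z
    obtain ⟨X, T, rfl⟩ := hz.exists_eq hε
    simp only [floor_xCoord_primalPoint, floor_tCoord_primalPoint]

end Coordinates

/-! ### Elimination of the dual points -/

section Elimination

variable {m ε : ℝ}

theorem normFactor_mul (m ε δ : ℝ) :
    (normFactor (m * ε) δ : ℂ) = 1 / (√(1 + m ^ 2 * ε ^ 2) : ℝ) * (1 / (√(1 - δ ^ 2) : ℝ)) := by
  rw [normFactor, mul_pow]
  push_cast
  rfl

theorem SatisfiesAxioms.solvesReduced {hε : ε ≠ 0} {A : (fullLattice ε → ℂ) × (fullLattice ε → ℂ)}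
    (hA : SatisfiesAxioms m ε hε δ A) :
    SolvesReduced (m * ε) δ 2 (fun X T => A.1 (primalPoint hε X T))
      (fun X T => A.2 (primalPoint hε X T)) where
  eq₁ X T := by
    have h := (hA.axiom₁ _ (isPrimalPoint_primalPoint hε X T)).1
    obtain ⟨h₁, h₂⟩ := hA.axiom₂ _ (isDualPoint_dualPoint hε X (T - 1))
    rw [shiftRight_primalPoint] at h
    rw [shiftRight_dualPoint] at h₁
    rw [shiftLeft_dualPoint] at h₂
    rw [h, h₁, h₂, normFactor_mul]
    push_cast
    ring
  eq₂ X T := by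
    have h := (hA.axiom₁ _ (isPrimalPoint_primalPoint hε X T)).2
    obtain ⟨h₁, h₂⟩ := hA.axiom₂ _ (isDualPoint_dualPoint hε (X - 1) (T - 1))
    rw [shiftLeft_primalPoint, originDelta_primalPoint] at h
    rw [shiftRight_dualPoint, sub_add_cancel] at h₁
    rw [shiftLeft_dualPoint] at h₂
    rw [h, h₁, h₂, normFactor_mul]
    push_cast
    ring

theorem SatisfiesAxioms.summable {hε : ε ≠ 0} {A : (fullLattice ε → ℂ) × (fullLattice ε → ℂ)}
    (hA : SatisfiesAxioms m ε hε δ A) :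
    Summable fun q : ℤ × ℤ => ‖A.1 (primalPoint hε q.1 q.2)‖ ^ 2 +
      ‖A.2 (primalPoint hε q.1 q.2)‖ ^ 2 :=
  (primalEquiv hε).summable_iff.mpr hA.axiom₃

/-- The values at the dual points are determined by the values at the primal points. -/
theorem SatisfiesAxioms.ext_primal {hε : ε ≠ 0} {A A' : (fullLattice ε → ℂ) × (fullLattice ε → ℂ)}
    (hA : SatisfiesAxioms m ε hε δ A) (hA' : SatisfiesAxioms m ε hε δ A')
    (h₁ : ∀ X T, A.1 (primalPoint hε X T) = A'.1 (primalPoint hε X T))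
    (h₂ : ∀ X T, A.2 (primalPoint hε X T) = A'.2 (primalPoint hε X T)) : A = A' := by
  have key : ∀ z, A.1 z = A'.1 z ∧ A.2 z = A'.2 z := by
    intro z
    rcases isPrimalPoint_or_isDualPoint z with hz | hz
    · obtain ⟨X, T, rfl⟩ := hz.exists_eq hε
      exact ⟨h₁ X T, h₂ X T⟩
    · rw [(hA.axiom₂ z hz).1, (hA.axiom₂ z hz).2, (hA'.axiom₂ z hz).1, (hA'.axiom₂ z hz).2]
      obtain ⟨X, T, rfl⟩ := hz.exists_eq hε
      simp only [shiftRight_dualPoint, shiftLeft_dualPoint, h₁, h₂, and_self]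
  exact Prod.ext (funext fun z => (key z).1) (funext fun z => (key z).2)

theorem SatisfiesAxioms.unique {hε : ε ≠ 0} {A A' : (fullLattice ε → ℂ) × (fullLattice ε → ℂ)}
    (hμ : 0 < m * ε) (hδ : 0 < δ) (hδ₁ : δ < 1)
    (hA : SatisfiesAxioms m ε hε δ A) (hA' : SatisfiesAxioms m ε hε δ A') : A = A' := by
  obtain ⟨h₁, h₂⟩ := hA.solvesReduced.unique hμ hδ hδ₁ hA'.solvesReduced hA.summable hA'.summable
  exact hA.ext_primal hA' (fun X T => congrFun (congrFun h₁ X) T)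
    fun X T => congrFun (congrFun h₂ X) T

open Classical in
/-- The extension of a pair of functions on `ℤ²` to the full lattice which satisfies the
equations at the dual points. The floor functions recover the integer coordinates of both the
primal and the dual points. -/
def extendToDual (ε δ : ℝ) (B₁ B₂ : ℤ → ℤ → ℂ) : (fullLattice ε → ℂ) × (fullLattice ε → ℂ) :=
  (fun z => if IsPrimalPoint z then B₁ ⌊xCoord z / ε⌋ ⌊tCoord z / ε⌋ else
    1 / (√(1 - δ ^ 2) : ℝ) * (B₁ (⌊xCoord z / ε⌋ + 1) ⌊tCoord z / ε⌋ -
      I * δ * B₂ (⌊xCoord z / ε⌋ + 1) ⌊tCoord z / ε⌋),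
   fun z => if IsPrimalPoint z then B₂ ⌊xCoord z / ε⌋ ⌊tCoord z / ε⌋ else
    1 / (√(1 - δ ^ 2) : ℝ) * (B₂ ⌊xCoord z / ε⌋ ⌊tCoord z / ε⌋ +
      I * δ * B₁ ⌊xCoord z / ε⌋ ⌊tCoord z / ε⌋))

variable {B₁ B₂ : ℤ → ℤ → ℂ}

theorem extendToDual_primalPoint (hε : ε ≠ 0) (X T : ℤ) :
    (extendToDual ε δ B₁ B₂).1 (primalPoint hε X T) = B₁ X T ∧
    (extendToDual ε δ B₁ B₂).2 (primalPoint hε X T) = B₂ X T := by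
  simp only [extendToDual, if_pos (isPrimalPoint_primalPoint hε X T), floor_xCoord_primalPoint,
    floor_tCoord_primalPoint, and_self]

theorem extendToDual_dualPoint (hε : ε ≠ 0) (X T : ℤ) :
    (extendToDual ε δ B₁ B₂).1 (dualPoint hε X T) =
      1 / (√(1 - δ ^ 2) : ℝ) * (B₁ (X + 1) T - I * δ * B₂ (X + 1) T) ∧
    (extendToDual ε δ B₁ B₂).2 (dualPoint hε X T) =
      1 / (√(1 - δ ^ 2) : ℝ) * (B₂ X T + I * δ * B₁ X T) := by
  have hx : ⌊xCoord (dualPoint hε X T) / ε⌋ = X := floor_mul_add_half_div hε X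
  have ht : ⌊tCoord (dualPoint hε X T) / ε⌋ = T := floor_mul_add_half_div hε T
  simp only [extendToDual, if_neg (not_isPrimalPoint_dualPoint hε X T), hx, ht, and_self]

theorem SolvesReduced.satisfiesAxioms (hε : ε ≠ 0) (hB : SolvesReduced (m * ε) δ 2 B₁ B₂)
    (hs : Summable fun q : ℤ × ℤ => ‖B₁ q.1 q.2‖ ^ 2 + ‖B₂ q.1 q.2‖ ^ 2) :
    SatisfiesAxioms m ε hε δ (extendToDual ε δ B₁ B₂) where
  axiom₁ z hz := by
    obtain ⟨X, T, rfl⟩ := hz.exists_eq hε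
    rw [shiftRight_primalPoint, shiftLeft_primalPoint, originDelta_primalPoint,
      (extendToDual_primalPoint hε X T).1, (extendToDual_primalPoint hε X T).2,
      (extendToDual_dualPoint hε X (T - 1)).1, (extendToDual_dualPoint hε X (T - 1)).2,
      (extendToDual_dualPoint hε (X - 1) (T - 1)).1, (extendToDual_dualPoint hε (X - 1) (T - 1)).2,
      hB.eq₁ X T, hB.eq₂ X T, normFactor_mul, sub_add_cancel]
    push_cast
    constructor <;> ring
  axiom₂ z hz := by
    obtain ⟨X, T, rfl⟩ := hz.exists_eq hε
    rw [shiftRight_dualPoint, shiftLeft_dualPoint, (extendToDual_dualPoint hε X T).1,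
      (extendToDual_dualPoint hε X T).2, (extendToDual_primalPoint hε X T).1,
      (extendToDual_primalPoint hε X T).2, (extendToDual_primalPoint hε (X + 1) T).1,
      (extendToDual_primalPoint hε (X + 1) T).2]
    exact ⟨rfl, rfl⟩
  axiom₃ := by
    rw [← (primalEquiv hε).summable_iff]
    refine (summable_congr fun q => ?_).mpr hs
    simp only [Function.comp_apply, primalEquiv, Equiv.coe_fn_mk,
      (extendToDual_primalPoint hε q.1 q.2).1, (extendToDual_primalPoint hε q.1 q.2).2]

end Elimination

/-! ### The lattice propagator -/

section Propagator

variable {m ε : ℝ}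

/-- The solution of the axioms given by Fourier integrals. -/
def fourierPair (m ε δ : ℝ) : (fullLattice ε → ℂ) × (fullLattice ε → ℂ) :=
  extendToDual ε δ (fun X T => fourierIntegral (mode₁ (m * ε) δ T) X)
    (fun X T => fourierIntegral (mode₂ (m * ε) δ T) X)

theorem fourierPair_satisfiesAxioms (hm : 0 < m) (hε : 0 < ε) (hδ : 0 < δ) (hδ₁ : δ < 1) :
    SatisfiesAxioms m ε hε.ne' δ (fourierPair m ε δ) :=
  (fourierIntegral_mode_solves (mul_pos hm hε) hδ.le hδ₁).satisfiesAxioms hε.ne'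
    (summable_fourierIntegral_mode (mul_pos hm hε) hδ hδ₁)

theorem axiomaticPair_eq_fourierPair (hm : 0 < m) (hε : 0 < ε) (hδ : 0 < δ) (hδ₁ : δ < 1) :
    axiomaticPair m ε hε.ne' δ = fourierPair m ε δ := by
  have h := fourierPair_satisfiesAxioms hm hε hδ hδ₁
  exact (Classical.epsilon_spec (p := SatisfiesAxioms m ε hε.ne' δ) ⟨_, h⟩).unique
    (mul_pos hm hε) hδ hδ₁ h

theorem tendsto_axiomaticPair₁ (hm : 0 < m) (hε : 0 < ε) (X T : ℤ) :
    Tendsto (fun δ => (axiomaticPair m ε hε.ne' δ).1 (primalPoint hε.ne' X T)) (𝓝[>] 0)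
      (𝓝 (fourierIntegral (mode₁ (m * ε) 0 T) X)) := by
  refine (tendsto_fourierIntegral (V := fun δ => mode₁ (m * ε) δ T) (fun d hd h =>
    continuous_mode₁_comp (mul_pos hm hε) hd continuous_snd h T) X).congr' ?_
  filter_upwards [Ioo_mem_nhdsGT one_pos] with δ hδ
  rw [axiomaticPair_eq_fourierPair hm hε hδ.1 hδ.2, fourierPair,
    (extendToDual_primalPoint hε.ne' X T).1]

theorem tendsto_axiomaticPair₂ (hm : 0 < m) (hε : 0 < ε) (X T : ℤ) :
    Tendsto (fun δ => (axiomaticPair m ε hε.ne' δ).2 (primalPoint hε.ne' X T)) (𝓝[>] 0)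
      (𝓝 (fourierIntegral (mode₂ (m * ε) 0 T) X)) := by
  refine (tendsto_fourierIntegral (V := fun δ => mode₂ (m * ε) δ T) (fun d hd h =>
    continuous_mode₂_comp (mul_pos hm hε) hd continuous_snd h T) X).congr' ?_
  filter_upwards [Ioo_mem_nhdsGT one_pos] with δ hδ
  rw [axiomaticPair_eq_fourierPair hm hε hδ.1 hδ.2, fourierPair,
    (extendToDual_primalPoint hε.ne' X T).2]

theorem omega_eq (m ε p : ℝ) : omega m ε p = 1 / ε * latticeFreq (m * ε) (p * ε) := by
  rw [omega, latticeFreq, mul_pow]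

theorem integral_rescale (hε : 0 < ε) (f : ℝ → ℂ) :
    ∫ p in (-Real.pi / ε)..(Real.pi / ε), f (p * ε) =
      (ε : ℂ)⁻¹ * ∫ p in (-Real.pi)..Real.pi, f p := by
  rw [intervalIntegral.integral_comp_mul_right _ hε.ne', div_mul_cancel₀ _ hε.ne',
    div_mul_cancel₀ _ hε.ne', real_smul, ofReal_inv]

theorem planeWave_primalPoint (hε : 0 < ε) (X T : ℤ) (p : ℝ) :
    exp (I * p * xCoord (primalPoint hε.ne' X T) -
      I * omega m ε p * tCoord (primalPoint hε.ne' X T)) =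
      exp (I * (p * ε : ℝ) * X - I * latticeFreq (m * ε) (p * ε) * T) := by
  have : (ε : ℂ) ≠ 0 := ofReal_ne_zero.mpr hε.ne'
  rw [omega_eq]
  simp only [xCoord, tCoord, primalPoint]
  congr 1
  push_cast
  field_simp

/-- In integer coordinates the sign of `Ã_k` is `(-1)^(X+T+k+1)` for `T < 0`. -/
theorem fourierSign_primalPoint (hε : 0 < ε) (k : ℕ) (X T : ℤ) :
    fourierSign k (primalPoint hε.ne' X T) = if T < 0 then (-1) ^ (X + T + k + 1) else 1 := by
  have ht : tCoord (primalPoint hε.ne' X T) < 0 ↔ T < 0 := by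
    simp only [tCoord, primalPoint]
    simp [mul_neg_iff, hε, hε.not_gt]
  have hev : IsEvenInteger ((xCoord (primalPoint hε.ne' X T) +
      tCoord (primalPoint hε.ne' X T)) / ε + k) ↔ Even (X + T + k) := by
    have e : (xCoord (primalPoint hε.ne' X T) + tCoord (primalPoint hε.ne' X T)) / ε + k =
        ((X + T + k : ℤ) : ℝ) := by
      simp only [xCoord, tCoord, primalPoint]
      push_cast
      field_simp
    rw [e]
    exact ⟨fun ⟨n, hn, h⟩ => by rwa [Int.cast_injective h], fun h => ⟨_, h, rfl⟩⟩
  simp only [fourierSign, ht, hev]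
  by_cases hT : T < 0
  · rcases Int.even_or_odd (X + T + k) with h | h
    · rw [if_pos ⟨hT, h⟩, if_pos hT, h.add_one.neg_one_zpow]
    · rw [if_neg fun h' => Int.not_even_iff_odd.mpr h h'.2, if_pos hT, h.add_one.neg_one_zpow]
  · rw [if_neg fun h => hT h.1, if_neg hT]

theorem neg_one_zpow_add_two (n : ℤ) : (-1 : ℂ) ^ (n + 2) = (-1) ^ n := by
  rw [zpow_add₀ (neg_ne_zero.mpr one_ne_zero), even_two.neg_one_zpow, mul_one]

theorem fourierIntegral_mode₁_eq (hε : 0 < ε) (X T : ℤ) :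
    fourierIntegral (mode₁ (m * ε) 0 T) X =
      fourierSign 1 (primalPoint hε.ne' X T) * (I * m * ε ^ 2 / (2 * Real.pi)) *
        ∫ p in (-Real.pi / ε)..(Real.pi / ε),
          exp (I * p * xCoord (primalPoint hε.ne' X T) -
            I * omega m ε p * tCoord (primalPoint hε.ne' X T)) /
              (√(m ^ 2 * ε ^ 2 + Real.sin (p * ε) ^ 2) : ℝ) := by
  have hε' : (ε : ℂ) ≠ 0 := ofReal_ne_zero.mpr hε.ne'
  simp only [planeWave_primalPoint hε]
  rw [integral_rescale hε fun p => exp (I * p * X - I * latticeFreq (m * ε) p * T) /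
    (√(m ^ 2 * ε ^ 2 + Real.sin p ^ 2) : ℝ), fourierIntegral_mode₁_zero, fourierSign_primalPoint hε,
    show (X + T + (1 : ℕ) + 1 : ℤ) = X + T + 2 by push_cast; ring,
    neg_one_zpow_add_two, mul_pow]
  generalize (∫ p in (-Real.pi)..Real.pi, exp (I * p * X - I * latticeFreq (m * ε) p * T) /
    (√(m ^ 2 * ε ^ 2 + Real.sin p ^ 2) : ℝ) : ℂ) = J
  push_cast
  field_simp

theorem fourierIntegral_mode₂_eq (hε : 0 < ε) (X T : ℤ) :
    fourierIntegral (mode₂ (m * ε) 0 T) X =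
      fourierSign 2 (primalPoint hε.ne' X T) * (ε / (2 * Real.pi)) *
        ∫ p in (-Real.pi / ε)..(Real.pi / ε),
          (1 + (Real.sin (p * ε) / √(m ^ 2 * ε ^ 2 + Real.sin (p * ε) ^ 2) : ℝ)) *
            exp (I * p * xCoord (primalPoint hε.ne' X T) -
              I * omega m ε p * tCoord (primalPoint hε.ne' X T)) := by
  have hε' : (ε : ℂ) ≠ 0 := ofReal_ne_zero.mpr hε.ne'
  simp only [planeWave_primalPoint hε]
  rw [integral_rescale hε fun p => (1 + (Real.sin p / √(m ^ 2 * ε ^ 2 + Real.sin p ^ 2) : ℝ)) *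
    exp (I * p * X - I * latticeFreq (m * ε) p * T), fourierIntegral_mode₂_zero,
    fourierSign_primalPoint hε,
    show (X + T + (2 : ℕ) + 1 : ℤ) = X + T + 2 + 1 by push_cast; ring,
    zpow_add_one₀ (neg_ne_zero.mpr one_ne_zero), neg_one_zpow_add_two,
    mul_neg_one, mul_pow]
  generalize (∫ p in (-Real.pi)..Real.pi, (1 + (Real.sin p /
    √(m ^ 2 * ε ^ 2 + Real.sin p ^ 2) : ℝ)) *
      exp (I * p * X - I * latticeFreq (m * ε) p * T) : ℂ) = J
  field_simp

end Propagator

end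

theorem mainTheorem2 (m ε : ℝ) (hm : 0 < m) (hε : 0 < ε) :
    (∀ δ : ℝ, 0 < δ → δ < 1 →
      ∃! A : (fullLattice ε → ℂ) × (fullLattice ε → ℂ), SatisfiesAxioms m ε hε.ne' δ A) ∧
    ∀ z : fullLattice ε, IsPrimalPoint z →
      Tendsto (fun δ : ℝ => (axiomaticPair m ε hε.ne' δ).1 z) (𝓝[>] (0 : ℝ))
        (𝓝 (propagator₁ m ε hε.ne' z)) ∧
      Tendsto (fun δ : ℝ => (axiomaticPair m ε hε.ne' δ).2 z) (𝓝[>] (0 : ℝ))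
        (𝓝 (propagator₂ m ε hε.ne' z)) ∧
      propagator₁ m ε hε.ne' z =
        fourierSign 1 z * (I * m * ε ^ 2 / (2 * Real.pi)) *
          ∫ p in (-Real.pi / ε)..(Real.pi / ε),
            exp (I * p * xCoord z - I * omega m ε p * tCoord z) /
              (√(m ^ 2 * ε ^ 2 + Real.sin (p * ε) ^ 2) : ℝ) ∧
      propagator₂ m ε hε.ne' z =
        fourierSign 2 z * (ε / (2 * Real.pi)) *
          ∫ p in (-Real.pi / ε)..(Real.pi / ε),
            (1 + (Real.sin (p * ε) / √(m ^ 2 * ε ^ 2 + Real.sin (p * ε) ^ 2) : ℝ)) *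
              exp (I * p * xCoord z - I * omega m ε p * tCoord z) := by
  refine ⟨fun δ hδ hδ₁ => ⟨fourierPair m ε δ, fourierPair_satisfiesAxioms hm hε hδ hδ₁,
    fun A hA => hA.unique (mul_pos hm hε) hδ hδ₁ (fourierPair_satisfiesAxioms hm hε hδ hδ₁)⟩, ?_⟩
  intro z hz
  obtain ⟨X, T, rfl⟩ := hz.exists_eq hε.ne'
  have h₁ := tendsto_axiomaticPair₁ hm hε X T
  have h₂ := tendsto_axiomaticPair₂ hm hε X T
  have e₁ : propagator₁ m ε hε.ne' (primalPoint hε.ne' X T) = _ := h₁.limUnder_eq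
  have e₂ : propagator₂ m ε hε.ne' (primalPoint hε.ne' X T) = _ := h₂.limUnder_eq
  rw [e₁, e₂]
  exact ⟨h₁, h₂, fourierIntegral_mode₁_eq hε X T, fourierIntegral_mode₂_eq hε X T⟩
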